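/- An algebraic computation tree over $\mathbb R$ works on real registers; each of its nodes either performs one exact operation $+,-,\times,/$ on registers or real constants and stores the result in a register (a *flop*; division by $0$ makes the output undefined), or compares a register or a constant with $0$ and branches according to whether it is $\ge 0$ (a *comparison*), or is a leaf that outputs a natural number. Its numbers of flops and of comparisons are the maxima over all root-to-leaf paths. There is an absolute constant $C$ such that for all integers $n\ge 1$ and $h\ge 1$ there is an algebraic computation tree $T$ with at most $C\,h\,n\log(n+1)$ flops and at most $C\,n$ comparisons of real numbers with $0$ with the following property. Let $p(x)=\sum_{i=0}^n p_ix^i$ be any polynomial with real coefficients and $p_n\ne 0$ for which the unit disc $D(0,1)=\{x\in\mathbb C:|x|\le 1\}$ is $s$-isolated with $s=9^{1/2^h}$, that is, every complex root $x$ of $p$ with $|x|\le s$ satisfies $|x|\le 1$. Then $T$, applied to the input $(p_0,\dots,p_n)$, is defined and outputs the number of complex roots of $p$, counted with multiplicity, in $D(0,1)$. (Thus $O(hn\log n)$ flops and $O(n)$ comparisons of real numbers with $0$ suffice.) -/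

import Mathlib

open Polynomial

/-- The disc `D(c, r)` (closed) is `γ`-isolated for `p` if it contains all complex roots of `p`
that lie in the concentric disc `D(c, γ r)`. -/
def IsIsolatedDisc (p : ℝ[X]) (γ : ℝ) (c : ℂ) (r : ℝ) : Prop :=
  ∀ z : ℂ, aeval z p = 0 → z ∈ Metric.closedBall c (γ * r) → z ∈ Metric.closedBall c r

open Classical in
/-- The number of complex roots of `p`, counted with multiplicity, in the closed disc `D(c, r)`. -/
noncomputable def rootCount (p : ℝ[X]) (c : ℂ) (r : ℝ) : ℕ :=
  (p.aroots ℂ).countP (fun z => z ∈ Metric.closedBall c r)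

/-- The four arithmetic operations. -/
inductive ArithOp
  | add
  | sub
  | mul
  | div

/-- The exact result of an arithmetic operation; division by zero is undefined. -/
noncomputable def ArithOp.apply : ArithOp → ℝ → ℝ → Option ℝ
  | .add, x, y => some (x + y)
  | .sub, x, y => some (x - y)
  | .mul, x, y => some (x * y)
  | .div, x, y => open Classical in if y = 0 then none else some (x / y)

/-- An operand is the current content of a register or a real constant. -/
inductive Operand
  | reg (i : ℕ)
  | const (c : ℝ)

/-- The value of an operand when the registers hold `m`. -/
def Operand.val (m : ℕ → ℝ) : Operand → ℝ
  | .reg i => m i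
  | .const c => c

/-- Algebraic computation trees over `ℝ` whose leaves are labelled with natural numbers.
`arith d o a b t` stores `a o b` in register `d` and continues with `t`;
`branch a t u` compares the real number `a` with `0` and continues with `t` if `0 ≤ a`
and with `u` otherwise; `leaf k` stops with output `k`. -/
inductive CompTree
  | leaf (k : ℕ)
  | arith (d : ℕ) (o : ArithOp) (a b : Operand) (t : CompTree)
  | branch (a : Operand) (t u : CompTree)

namespace CompTree

/-- The output of a tree on the register contents `m`; it is `none` if the computation
divides by zero. -/
noncomputable def run : CompTree → (ℕ → ℝ) → Option ℕ
  | leaf k, _ => some k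
  | arith d o a b t, m =>
      (o.apply (a.val m) (b.val m)).bind fun x => t.run (Function.update m d x)
  | branch a t u, m => open Classical in if 0 ≤ a.val m then t.run m else u.run m

/-- The largest number of arithmetic operations (flops) on a path from the root to a leaf. -/
def flops : CompTree → ℕ
  | leaf _ => 0
  | arith _ _ _ _ t => t.flops + 1
  | branch _ t u => max t.flops u.flops

/-- The largest number of comparisons with `0` on a path from the root to a leaf. -/
def comparisons : CompTree → ℕ
  | leaf _ => 0
  | arith _ _ _ _ t => t.comparisons
  | branch _ t u => max t.comparisons u.comparisons + 1

end CompTree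

/-! Apply the Dandelin–Graeffe transform `h` times. The roots of the resulting `q` are the powers `z
^ 2 ^ h` of the roots `z` of `p`, with multiplicity (`aroots_iterate_graeffe`). Roots in the unit
disc stay there, and a root with `|z| > 9 ^ (1 / 2 ^ h)` is sent outside the disc of radius 9. The
circle `|u| = 3` is thus at ratio at least 3 from every root, and the number of roots in the unit
disc is unchanged.

On this circle `u q'(u) / q(u)` is the sum of `1 / (1 - z / u)` over the roots `z` of `q`. Its mean
over `N` equally spaced points is the sum of `1 / (1 - (z / 3) ^ N)` (`logDerivSum_eq`), where each
term is within `1 / (3 ^ N - 1)` of 1 for an inner root and of 0 for an outer one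
(`norm_sum_inv_sub_countP_le`). Hence `N = O(log n)` points bring the total error below 1/2
(`abs_logDerivSum_sub_lt`).

Each squaring costs `O(n log n)` by fast Fourier transforms (`StraightLine.graeffe`), and direct
evaluation at the `N` points costs `O(n log n)` in all. None of this branches; the only comparisons
are the `n` that round the mean to an integer (`StraightLine.exists_tree_of_approx`). -/

/-! ### Straight-line programs -/

/-- A function of the input is available from `K` if it lies in `K` or is constant. -/
def Available {X : Type*} (K : Set (X → ℝ)) (f : X → ℝ) : Prop :=
  f ∈ K ∨ ∃ c : ℝ, f = fun _ => c

/-- `StraightLine K c L`: the functions in `L` can be computed from those in `K` and real constants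
with at most `c` arithmetic operations, none of which divides by zero on any input. -/
inductive StraightLine {X : Type*} : Set (X → ℝ) → ℕ → Set (X → ℝ) → Prop
  | nil {K L : Set (X → ℝ)} (c : ℕ) (h : ∀ f ∈ L, Available K f) : StraightLine K c L
  | step {K L : Set (X → ℝ)} {c : ℕ} (o : ArithOp) (a b g : X → ℝ)
      (ha : Available K a) (hb : Available K b) (hg : ∀ x, o.apply (a x) (b x) = some (g x))
      (h : StraightLine (insert g K) c L) : StraightLine K (c + 1) L

namespace Available

variable {X : Type*} {K K' : Set (X → ℝ)} {f : X → ℝ}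

theorem const (K : Set (X → ℝ)) (c : ℝ) : Available K (fun _ => c) := Or.inr ⟨c, rfl⟩

theorem of_mem (h : f ∈ K) : Available K f := Or.inl h

theorem trans (h : ∀ g ∈ K', Available K g) (hf : Available K' f) : Available K f := by
  rcases hf with hf | hf
  · exact h f hf
  · exact Or.inr hf

theorem mono (h : K' ⊆ K) (hf : Available K' f) : Available K f :=
  hf.imp (fun hf => h hf) id

end Available

namespace StraightLine

variable {X : Type*} {K K' L L' M : Set (X → ℝ)} {a b c : ℕ} {f g : X → ℝ}

theorem of_available_left (h : StraightLine K' c L) (hK : ∀ g ∈ K', Available K g) :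
    StraightLine K c L := by
  induction h generalizing K with
  | nil c h => exact nil c fun f hf => (h f hf).trans hK
  | step o a b g ha hb hg _ ih =>
    refine step o a b g (ha.trans hK) (hb.trans hK) hg (ih ?_)
    rintro f (rfl | hf)
    · exact .of_mem (Set.mem_insert _ _)
    · exact (hK f hf).mono (Set.subset_insert _ _)

theorem mono_left (h : StraightLine K' c L) (hK : K' ⊆ K) : StraightLine K c L :=
  h.of_available_left fun _ hg => .of_mem (hK hg)

theorem of_available_right (h : StraightLine K c L) (hL : ∀ g ∈ L', Available L g) :
    StraightLine K c L' := by
  induction h with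
  | nil c h => exact nil c fun f hf => (hL f hf).trans h
  | step o a b g ha hb hg _ ih => exact step o a b g ha hb hg (ih hL)

theorem mono_right (h : StraightLine K c L) (hL : L' ⊆ L) : StraightLine K c L' :=
  h.of_available_right fun _ hg => .of_mem (hL hg)

theorem mono_cost (h : StraightLine K a L) (hab : a ≤ b) : StraightLine K b L := by
  induction h generalizing b with
  | nil c h => exact nil b h
  | step o a b' g ha hb hg _ ih =>
    obtain ⟨b, rfl⟩ : ∃ d, b = d + 1 := ⟨b - 1, by omega⟩
    exact step o a b' g ha hb hg (ih (by omega))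

/-- Steps only enlarge the set of known functions, so the inputs survive and can be passed to a
later program. -/
theorem keep (h : StraightLine K c L) : StraightLine K c (K ∪ L) := by
  induction h with
  | nil c h => exact nil c fun f hf => hf.elim .of_mem (h f)
  | step o a b g ha hb hg _ ih =>
    exact step o a b g ha hb hg
      (ih.mono_right (Set.union_subset_union_left _ (Set.subset_insert _ _)))

theorem trans (h₁ : StraightLine K a L) (h₂ : StraightLine (K ∪ L) b M) :
    StraightLine K (a + b) M := by
  induction h₁ with
  | nil c h =>
    exact (h₂.of_available_left fun f hf => hf.elim .of_mem (h f)).mono_cost (by omega)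
  | step o a b' g ha hb hg _ ih =>
    rw [Nat.add_right_comm]
    exact step o a b' g ha hb hg
      (ih (h₂.mono_left (Set.union_subset_union_left _ (Set.subset_insert _ _))))

theorem union (h₁ : StraightLine K a L) (h₂ : StraightLine K b M) :
    StraightLine K (a + b) (L ∪ M) := by
  refine h₁.trans ((h₂.mono_left (K := K ∪ L) Set.subset_union_left).keep.mono_right ?_)
  intro f hf
  rcases hf with hf | hf
  · exact Or.inl (Or.inr hf)
  · exact Or.inr hf

theorem of_available (h : Available K f) : StraightLine K 0 {f} :=
  nil 0 (by rintro _ rfl; exact h)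

theorem const (K : Set (X → ℝ)) (r : ℝ) : StraightLine K 0 {fun _ => r} :=
  of_available (.const K r)

theorem op (o : ArithOp) {r : X → ℝ} (hf : StraightLine K a {f}) (hg : StraightLine K b {g})
    (hr : ∀ x, o.apply (f x) (g x) = some (r x)) : StraightLine K (a + b + 1) {r} := by
  refine (hf.union hg).trans (step (c := 0) o f g r ?_ ?_ hr (of_available ?_))
  · exact .of_mem (by simp)
  · exact .of_mem (by simp)
  · exact .of_mem (by simp)

theorem add (hf : StraightLine K a {f}) (hg : StraightLine K b {g}) :
    StraightLine K (a + b + 1) {fun x => f x + g x} := hf.op .add hg fun _ => rfl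

theorem sub (hf : StraightLine K a {f}) (hg : StraightLine K b {g}) :
    StraightLine K (a + b + 1) {fun x => f x - g x} := hf.op .sub hg fun _ => rfl

theorem mul (hf : StraightLine K a {f}) (hg : StraightLine K b {g}) :
    StraightLine K (a + b + 1) {fun x => f x * g x} := hf.op .mul hg fun _ => rfl

theorem div (hf : StraightLine K a {f}) (hg : StraightLine K b {g}) (h0 : ∀ x, g x ≠ 0) :
    StraightLine K (a + b + 1) {fun x => f x / g x} :=
  hf.op .div hg fun x => by simp [ArithOp.apply, h0 x]

/-- Computing a family of sets, each at cost `a`. -/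
theorem iUnion {F : ℕ → Set (X → ℝ)} (m : ℕ) (h : ∀ i < m, StraightLine K a (F i)) :
    StraightLine K (m * a) {f | ∃ i < m, f ∈ F i} := by
  induction m with
  | zero => exact nil _ (by simp)
  | succ m ih =>
    rw [Nat.succ_mul]
    refine ((ih fun i hi => h i (by omega)).union (h m (by omega))).mono_right ?_
    rintro f ⟨i, hi, hf⟩
    rcases Nat.lt_succ_iff_lt_or_eq.mp hi with hi | rfl
    · exact Or.inl ⟨i, hi, hf⟩
    · exact Or.inr hf

theorem sum {F : ℕ → X → ℝ} (m : ℕ) (h : ∀ i < m, StraightLine K a {F i}) :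
    StraightLine K (m * (a + 1)) {fun x => ∑ i ∈ Finset.range m, F i x} := by
  induction m with
  | zero => simpa using const K 0
  | succ m ih =>
    rw [Nat.succ_mul]
    simp only [Finset.sum_range_succ]
    exact (ih fun i hi => h i (by omega)).add (h m (by omega))

/-- Linear combinations with constant coefficients. -/
theorem linearCombination {F : ℕ → X → ℝ} (w : ℕ → ℝ) (m : ℕ)
    (h : ∀ i < m, Available K (F i)) :
    StraightLine K (2 * m) {fun x => ∑ i ∈ Finset.range m, F i x * w i} :=
  (sum m fun i hi => (of_available (h i hi)).mul (const K (w i))).mono_cost (by omega)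

/-- A straight-line program can be prefixed to any computation tree. -/
theorem exists_prefix (h : StraightLine K c L) (m : X → ℕ → ℝ) (R : ℕ)
    (hK : ∀ f ∈ K, ∃ r < R, ∀ x, m x r = f x) :
    ∃ (m' : X → ℕ → ℝ) (P : CompTree → CompTree),
      (∀ T, (P T).flops ≤ T.flops + c ∧ (P T).comparisons = T.comparisons ∧
        ∀ x, (P T).run (m x) = T.run (m' x)) ∧
      ∀ f ∈ L, ∃ o : Operand, ∀ x, o.val (m' x) = f x := by
  have key : ∀ {K : Set (X → ℝ)} {m : X → ℕ → ℝ} {R : ℕ},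
      (∀ f ∈ K, ∃ r < R, ∀ x, m x r = f x) → ∀ f, Available K f →
      ∃ o : Operand, ∀ x, o.val (m x) = f x := by
    rintro K m R hK f (hf | ⟨r, rfl⟩)
    · obtain ⟨r, -, hr⟩ := hK f hf
      exact ⟨.reg r, hr⟩
    · exact ⟨.const r, fun _ => rfl⟩
  induction h generalizing m R with
  | nil c h =>
    exact ⟨m, id, fun T => ⟨by simp, rfl, fun _ => rfl⟩, fun f hf => key hK f (h f hf)⟩
  | step o a b g ha hb hg _ ih =>
    obtain ⟨oa, hoa⟩ := key hK a ha
    obtain ⟨ob, hob⟩ := key hK b hb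
    -- All known functions sit in registers below `R`, so writing to `R` destroys none of them.
    obtain ⟨m', P, hP, hL⟩ := ih (fun x => Function.update (m x) R (g x)) (R + 1) (by
      rintro f (rfl | hf)
      · exact ⟨R, by omega, fun x => by simp⟩
      · obtain ⟨r, hr, h⟩ := hK f hf
        exact ⟨r, by omega, fun x => by simp [Function.update_of_ne hr.ne, h x]⟩)
    refine ⟨m', fun T => .arith R o oa ob (P T), fun T => ?_, hL⟩
    obtain ⟨h1, h2, h3⟩ := hP T
    refine ⟨by simp only [CompTree.flops]; omega, h2, fun x => ?_⟩
    rw [CompTree.run, hoa, hob, hg, Option.bind_some, h3]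

end StraightLine

/-! ### Rounding to the nearest integer by comparisons -/

/-- The tree that compares the operands `o k, o (k + 1), …` with `0` and outputs the first index
whose operand is negative, giving up after `j` comparisons. -/
def searchTree (o : ℕ → Operand) : ℕ → ℕ → CompTree
  | 0, k => .leaf k
  | j + 1, k => .branch (o k) (searchTree o j (k + 1)) (.leaf k)

theorem searchTree_flops (o : ℕ → Operand) (j k : ℕ) : (searchTree o j k).flops = 0 := by
  induction j generalizing k with
  | zero => rfl
  | succ j ih => simp [searchTree, CompTree.flops, ih]

theorem searchTree_comparisons (o : ℕ → Operand) (j k : ℕ) :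
    (searchTree o j k).comparisons = j := by
  induction j generalizing k with
  | zero => rfl
  | succ j ih => simp [searchTree, CompTree.comparisons, ih]

theorem searchTree_run (o : ℕ → Operand) (m : ℕ → ℝ) (j k r : ℕ) (hk : k ≤ r) (hr : r ≤ k + j)
    (h : ∀ i, i < k + j → (0 ≤ (o i).val m ↔ i < r)) : (searchTree o j k).run m = some r := by
  induction j generalizing k with
  | zero => simp [searchTree, CompTree.run]; omega
  | succ j ih =>
    rw [searchTree, CompTree.run]
    by_cases hkr : k < r
    · rw [if_pos ((h k (by omega)).2 hkr)]
      exact ih (k + 1) hkr (by omega) fun i hi => h i (by omega)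
    · rw [if_neg fun h0 => hkr ((h k (by omega)).1 h0), CompTree.run]
      simp; omega

/-- If a straight-line program approximates a natural number `r x ≤ n`, scaled by `N`,
with error below `N / 2`, then a computation tree with `n` comparisons finds `r x`. -/
theorem StraightLine.exists_tree_of_approx {X : Type*} {c n R : ℕ} {K : Set (X → ℝ)} {f : X → ℝ}
    (h : StraightLine K c {f}) (m : X → ℕ → ℝ)
    (hK : ∀ f ∈ K, ∃ r < R, ∀ x, m x r = f x) (N : ℝ) (r : X → ℕ) (hr : ∀ x, r x ≤ n)
    (hf : ∀ x, |f x - N * r x| < N / 2) :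
    ∃ T : CompTree, T.flops ≤ c + n ∧ T.comparisons = n ∧ ∀ x, T.run (m x) = some (r x) := by
  -- The thresholds `N * (i + 1 / 2)` lie halfway between consecutive multiples of `N`, so the
  -- difference is nonnegative exactly when `i < r x`.
  have hs : StraightLine K (c + n * 1)
      {g | ∃ i < n, g ∈ ({fun x => f x - N * (i + 1 / 2)} : Set (X → ℝ))} :=
    h.trans (StraightLine.iUnion n fun i _ =>
      (StraightLine.of_available (.of_mem (by simp))).sub (.const _ _))
  obtain ⟨m', P, hP, hL⟩ := hs.exists_prefix m R hK
  -- The search tree takes a total family of operands; those with index at least `n` are never read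
  -- and get a dummy value.
  have hL' : ∀ i, ∃ o : Operand, i < n → ∀ x, o.val (m' x) = f x - N * (i + 1 / 2) := by
    intro i
    by_cases hi : i < n
    · obtain ⟨o, ho⟩ := hL _ ⟨i, hi, rfl⟩
      exact ⟨o, fun _ => ho⟩
    · exact ⟨.const 0, fun h => absurd h hi⟩
  choose o ho using hL'
  obtain ⟨h1, h2, h3⟩ := hP (searchTree o n 0)
  refine ⟨P (searchTree o n 0), ?_, ?_, fun x => ?_⟩
  · rw [searchTree_flops] at h1; omega
  · rw [h2, searchTree_comparisons]
  · rw [h3]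
    refine searchTree_run o _ n 0 (r x) (Nat.zero_le _) (by simpa using hr x) fun i hi => ?_
    rw [ho i (by omega)]
    have := abs_lt.mp (hf x)
    have hN : 0 < N := by linarith [abs_nonneg (f x - N * r x), hf x]
    constructor
    · intro h0
      by_contra hir
      have : (r x : ℝ) ≤ i := by exact_mod_cast not_lt.mp hir
      nlinarith
    · intro hir
      have : (i : ℝ) + 1 ≤ r x := by exact_mod_cast hir
      nlinarith

/-! ### The fast Fourier transform -/

/-- The real and imaginary parts of the first `m` functions of a complex-valued family. -/
def complexParts {X : Type*} (F : ℕ → X → ℂ) (m : ℕ) : Set (X → ℝ) :=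
  {g | ∃ i < m, g ∈ ({fun x => (F i x).re} ∪ {fun x => (F i x).im} : Set (X → ℝ))}

theorem re_mem_complexParts {X : Type*} (F : ℕ → X → ℂ) {i m : ℕ} (hi : i < m) :
    (fun x => (F i x).re) ∈ complexParts F m := ⟨i, hi, Or.inl rfl⟩

theorem im_mem_complexParts {X : Type*} (F : ℕ → X → ℂ) {i m : ℕ} (hi : i < m) :
    (fun x => (F i x).im) ∈ complexParts F m := ⟨i, hi, Or.inr rfl⟩

/-- The discrete Fourier transform of length `m` with respect to `w`. -/
def fourierSum {X : Type*} (m : ℕ) (w : ℂ) (a : ℕ → X → ℂ) (j : ℕ) (x : X) : ℂ :=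
  ∑ i ∈ Finset.range m, a i x * w ^ (i * j)

theorem fourierSum_two_mul {X : Type*} (m : ℕ) (w : ℂ) (a : ℕ → X → ℂ) (j : ℕ) (x : X) :
    fourierSum (2 * m) w a j x = fourierSum m (w ^ 2) (fun i => a (2 * i)) j x +
      w ^ j * fourierSum m (w ^ 2) (fun i => a (2 * i + 1)) j x := by
  unfold fourierSum
  induction m with
  | zero => simp
  | succ m ih =>
    rw [Nat.mul_succ, Finset.sum_range_succ, Finset.sum_range_succ, ih, Finset.sum_range_succ,
      Finset.sum_range_succ]
    ring

/-- Periodicity is what makes the transform fast: each value of a half-length transform serves two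
outputs of the full one. -/
theorem fourierSum_mod {X : Type*} {m : ℕ} {w : ℂ} (hw : w ^ m = 1) (a : ℕ → X → ℂ) (j : ℕ) :
    fourierSum m w a (j % m) = fourierSum m w a j := by
  funext x
  refine Finset.sum_congr rfl fun i _ => ?_
  conv_rhs => rw [← Nat.mod_add_div j m]
  rw [mul_add, pow_add, mul_left_comm i m, pow_mul w m, hw, one_pow, mul_one]

/-- Radix-2 recursion on even and odd indices. An output costs 8 real operations, a complex addition
and a multiplication by a constant, so the cost satisfies `c (k + 1) = 2 * c k + 8 * 2 ^ (k + 1)`.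
Primitivity of `w` is only needed for inversion. -/
theorem StraightLine.fft {X : Type*} {K : Set (X → ℝ)} (k : ℕ) (w : ℂ) (hw : w ^ 2 ^ k = 1)
    (a : ℕ → X → ℂ) (hre : ∀ i < 2 ^ k, Available K fun x => (a i x).re)
    (him : ∀ i < 2 ^ k, Available K fun x => (a i x).im) :
    StraightLine K (8 * k * 2 ^ k) (complexParts (fourierSum (2 ^ k) w a) (2 ^ k)) := by
  induction k generalizing w a with
  | zero =>
    refine .nil _ ?_
    rintro g ⟨i, hi, hg⟩
    have h0 : i = 0 := by simpa using hi
    subst h0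
    rcases hg with rfl | rfl
    · simpa [fourierSum] using hre 0 (by simp)
    · simpa [fourierSum] using him 0 (by simp)
  | succ k ih =>
    have hw2 : (w ^ 2) ^ 2 ^ k = 1 := by rw [← pow_mul, ← pow_succ', hw]
    have hlt : 2 ^ (k + 1) = 2 * 2 ^ k := pow_succ' 2 k
    set E := fourierSum (2 ^ k) (w ^ 2) (fun i => a (2 * i)) with hE
    set O := fourierSum (2 ^ k) (w ^ 2) (fun i => a (2 * i + 1)) with hO
    have h₁ : StraightLine K _ (complexParts E (2 ^ k)) :=
      ih (w ^ 2) hw2 _ (fun i hi => hre _ (by omega)) fun i hi => him _ (by omega)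
    have h₂ : StraightLine K _ (complexParts O (2 ^ k)) :=
      ih (w ^ 2) hw2 _ (fun i hi => hre _ (by omega)) fun i hi => him _ (by omega)
    have h₃ : StraightLine (K ∪ (complexParts E (2 ^ k) ∪ complexParts O (2 ^ k)))
        (2 ^ (k + 1) * 8) (complexParts (fourierSum (2 ^ (k + 1)) w a) (2 ^ (k + 1))) := by
      refine StraightLine.iUnion _ fun j _ => ?_
      have hj : j % 2 ^ k < 2 ^ k := Nat.mod_lt _ (by positivity)
      have hF : ∀ x, fourierSum (2 ^ (k + 1)) w a j x = E j x + w ^ j * O j x := by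
        intro x
        rw [hlt, fourierSum_two_mul]
      have hEj : E (j % 2 ^ k) = E j := fourierSum_mod hw2 _ j
      have hOj : O (j % 2 ^ k) = O j := fourierSum_mod hw2 _ j
      have e1 := re_mem_complexParts E hj
      have e2 := im_mem_complexParts E hj
      have o1 := re_mem_complexParts O hj
      have o2 := im_mem_complexParts O hj
      rw [hEj] at e1 e2
      rw [hOj] at o1 o2
      have av : ∀ g ∈ complexParts E (2 ^ k) ∪ complexParts O (2 ^ k),
          StraightLine (K ∪ (complexParts E (2 ^ k) ∪ complexParts O (2 ^ k))) 0 {g} :=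
        fun g hg => .of_available (.of_mem (Or.inr hg))
      have c1 := av _ (Or.inl e1)
      have c2 := av _ (Or.inl e2)
      have d1 := av _ (Or.inr o1)
      have d2 := av _ (Or.inr o2)
      have r := c1.add (((StraightLine.const _ (w ^ j).re).mul d1).sub
        ((StraightLine.const _ (w ^ j).im).mul d2))
      have s := c2.add (((StraightLine.const _ (w ^ j).re).mul d2).add
        ((StraightLine.const _ (w ^ j).im).mul d1))
      simp only [hF, Complex.add_re, Complex.mul_re, Complex.add_im, Complex.mul_im]
      exact r.union s
    refine ((h₁.union h₂).trans h₃).mono_cost (le_of_eq ?_)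
    ring

/-! ### Sums over roots of unity -/

/-- A geometric sum whose ratio is an `M`-th root of unity, equal to 1 only if `i = m`. -/
theorem IsPrimitiveRoot.sum_pow_mul_inv_pow {u : ℂ} {M : ℕ} (hu : IsPrimitiveRoot u M) {i m : ℕ}
    (hi : i < M) (hm : m < M) :
    ∑ j ∈ Finset.range M, (u ^ i * u⁻¹ ^ m) ^ j = if i = m then (M : ℂ) else 0 := by
  have hu0 : u ≠ 0 := hu.ne_zero (by omega)
  split_ifs with h
  · subst h
    simp [hu0]
  · have hr : u ^ i * u⁻¹ ^ m ≠ 1 := by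
      intro h1
      refine h (hu.pow_inj hi hm ?_)
      rwa [inv_pow, mul_inv_eq_one₀ (pow_ne_zero _ hu0)] at h1
    have hp : (u ^ i * u⁻¹ ^ m) ^ M = 1 := by
      rw [mul_pow, ← pow_mul, ← pow_mul, mul_comm i, mul_comm m, pow_mul, pow_mul, inv_pow,
        hu.pow_eq_one]
      simp
    have := mul_geom_sum (u ^ i * u⁻¹ ^ m) M
    rw [hp, sub_self] at this
    exact (mul_eq_zero.mp this).resolve_left (sub_ne_zero.mpr hr)

/-- Fourier inversion for polynomials. -/
theorem IsPrimitiveRoot.sum_aeval_mul_inv_pow {u : ℂ} {M : ℕ} (hu : IsPrimitiveRoot u M)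
    (q : ℝ[X]) (hq : q.natDegree < M) {m : ℕ} (hm : m < M) :
    ∑ j ∈ Finset.range M, aeval (u ^ j) q * u⁻¹ ^ (j * m) = (M * q.coeff m : ℝ) := by
  have h : ∀ j, aeval (u ^ j) q * u⁻¹ ^ (j * m) =
      ∑ i ∈ Finset.range M, (q.coeff i : ℂ) * (u ^ i * u⁻¹ ^ m) ^ j := by
    intro j
    rw [aeval_eq_sum_range' hq, Finset.sum_mul]
    refine Finset.sum_congr rfl fun i _ => ?_
    rw [Complex.real_smul, mul_pow, ← pow_mul, ← pow_mul, ← pow_mul, mul_comm j i, mul_comm j m,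
      mul_assoc]
  simp_rw [h]
  rw [Finset.sum_comm]
  have h2 : ∀ i ∈ Finset.range M, ∑ j ∈ Finset.range M,
      (q.coeff i : ℂ) * (u ^ i * u⁻¹ ^ m) ^ j = if i = m then (M * q.coeff m : ℂ) else 0 := by
    intro i hi
    rw [← Finset.mul_sum, hu.sum_pow_mul_inv_pow (Finset.mem_range.mp hi) hm]
    split_ifs with h
    · subst h; ring
    · simp
  rw [Finset.sum_congr rfl h2, Finset.sum_ite_eq' _ m, if_pos (Finset.mem_range.mpr hm)]
  push_cast
  ring

/-- Averaging `1 / (1 - y ω)` over all `N`-th roots of unity `ω`. -/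
theorem IsPrimitiveRoot.sum_inv_one_sub_mul_pow {v : ℂ} {N : ℕ} (hv : IsPrimitiveRoot v N)
    (hN : 0 < N) {y : ℂ} (hy : y ^ N ≠ 1) :
    ∑ j ∈ Finset.range N, (1 - y * v ^ j)⁻¹ = N * (1 - y ^ N)⁻¹ := by
  have hy' : 1 - y ^ N ≠ 0 := sub_ne_zero.mpr (Ne.symm hy)
  -- Since `(y * v ^ j) ^ N = y ^ N`, a finite geometric sum suffices and no bound on `|y|` is
  -- needed. The factor `v⁻¹ ^ 0` brings the sum into the shape of the orthogonality relation with
  -- `m = 0`.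
  have h : ∀ j, (1 - y * v ^ j)⁻¹ =
      (1 - y ^ N)⁻¹ * ∑ l ∈ Finset.range N, y ^ l * (v ^ l * v⁻¹ ^ 0) ^ j := by
    intro j
    have hp : (y * v ^ j) ^ N = y ^ N := by
      rw [mul_pow, ← pow_mul, mul_comm j, pow_mul, hv.pow_eq_one, one_pow, mul_one]
    have hg := mul_neg_geom_sum (y * v ^ j) N
    rw [hp] at hg
    have hs : ∑ l ∈ Finset.range N, y ^ l * (v ^ l * v⁻¹ ^ 0) ^ j =
        ∑ l ∈ Finset.range N, (y * v ^ j) ^ l := by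
      refine Finset.sum_congr rfl fun l _ => ?_
      rw [pow_zero, mul_one, mul_pow, ← pow_mul, ← pow_mul, mul_comm l j]
    have hne : 1 - y * v ^ j ≠ 0 := fun h0 => by
      rw [h0, zero_mul] at hg
      exact hy' hg.symm
    rw [hs, ← hg]
    have hs0 : ∑ l ∈ Finset.range N, (y * v ^ j) ^ l ≠ 0 := fun h0 => by
      rw [h0, mul_zero] at hg
      exact hy' hg.symm
    field_simp
  simp_rw [h]
  rw [← Finset.mul_sum, Finset.sum_comm]
  have h2 : ∀ l ∈ Finset.range N, ∑ j ∈ Finset.range N, y ^ l * (v ^ l * v⁻¹ ^ 0) ^ j =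
      if l = 0 then (N : ℂ) else 0 := by
    intro l hl
    rw [← Finset.mul_sum, hv.sum_pow_mul_inv_pow (Finset.mem_range.mp hl) hN]
    split_ifs with h
    · subst h; simp
    · simp
  rw [Finset.sum_congr rfl h2, Finset.sum_ite_eq' _ 0, if_pos (Finset.mem_range.mpr hN), mul_comm]

/-! ### Root squaring -/

/-- The Dandelin–Graeffe transform `q` of `p`, with `q (x ^ 2) = p x * p (-x)`. -/
noncomputable def graeffe (p : ℝ[X]) : ℝ[X] := contract 2 (p * p.comp (-X))

/-- The product is invariant under `x ↦ -x`, so its odd coefficients vanish and `contract` loses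
nothing. -/
theorem expand_graeffe (p : ℝ[X]) : expand ℝ 2 (graeffe p) = p * p.comp (-X) := by
  ext i
  rw [coeff_expand two_pos]
  split_ifs with h
  · rw [graeffe, coeff_contract two_ne_zero, Nat.div_mul_cancel h]
  · have hev : (p * p.comp (-X)).comp (-X) = p * p.comp (-X) := by
      rw [mul_comp, comp_assoc]
      simp [mul_comm]
    have hi := congrArg (fun f => coeff f i) hev
    have hX : (-X : ℝ[X]) = C (-1) * X := by simp
    simp only [hX, comp_C_mul_X_coeff] at hi ⊢
    rw [(Nat.odd_iff.mpr (Nat.two_dvd_ne_zero.mp h)).neg_one_pow] at hi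
    linarith

theorem aeval_graeffe (p : ℝ[X]) (z : ℂ) :
    aeval (z ^ 2) (graeffe p) = aeval z p * aeval (-z) p := by
  rw [← expand_aeval, expand_graeffe, map_mul, aeval_comp]
  simp

theorem natDegree_graeffe_le (p : ℝ[X]) : (graeffe p).natDegree ≤ p.natDegree := by
  have h := congrArg natDegree (expand_graeffe p)
  rw [natDegree_expand] at h
  have h2 : (p * p.comp (-X)).natDegree ≤ p.natDegree + p.natDegree * 1 :=
    natDegree_mul_le.trans (Nat.add_le_add_left (natDegree_comp_le.trans (by simp)) _)
  omega

theorem graeffe_ne_zero {p : ℝ[X]} (hp : p ≠ 0) : graeffe p ≠ 0 := by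
  intro h
  have h2 := expand_graeffe p
  rw [h, map_zero] at h2
  rcases mul_eq_zero.mp h2.symm with h3 | h3
  · exact hp h3
  · have := congrArg (fun f => f.comp (-X)) h3
    simp only [comp_assoc, zero_comp] at this
    exact hp (by simpa using this)

/-- Root by root, `(x - a) * (-x - a) = -(x ^ 2 - a ^ 2)`. -/
theorem prod_X_sub_C_mul_comp_neg (Z : Multiset ℂ) :
    (Z.map fun z => X - C z).prod * (Z.map fun z => X - C z).prod.comp (-X) =
      expand ℂ 2 (C ((-1) ^ Z.card) * ((Z.map (· ^ 2)).map fun z => X - C z).prod) := by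
  induction Z using Multiset.induction_on with
  | empty => simp
  | cons a Z ih =>
    simp only [Multiset.map_cons, Multiset.prod_cons, mul_comp, Multiset.card_cons, map_mul,
      map_sub, expand_X, expand_C] at ih ⊢
    rw [mul_mul_mul_comm, ih, pow_succ]
    simp only [sub_comp, X_comp, C_comp, map_mul, map_neg, map_one, map_pow]
    ring

theorem aroots_graeffe {p : ℝ[X]} (hp : p ≠ 0) :
    (graeffe p).aroots ℂ = (p.aroots ℂ).map (· ^ 2) := by
  have hP := (IsAlgClosed.splits (p.map (algebraMap ℝ ℂ))).eq_prod_roots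
  set Z := (p.map (algebraMap ℝ ℂ)).roots with hZ
  set a := (p.map (algebraMap ℝ ℂ)).leadingCoeff with ha
  have ha0 : a ≠ 0 := by
    rw [ha, leadingCoeff_ne_zero]
    exact map_ne_zero hp
  have hq : (graeffe p).map (algebraMap ℝ ℂ) =
      C (a ^ 2 * (-1) ^ Z.card) * ((Z.map (· ^ 2)).map fun z => X - C z).prod := by
    apply expand_injective (R := ℂ) two_pos
    rw [← map_expand, expand_graeffe, Polynomial.map_mul, map_comp, Polynomial.map_neg, map_X, hP,
      mul_comp, mul_mul_mul_comm, prod_X_sub_C_mul_comp_neg]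
    simp only [C_comp, map_mul, map_pow, expand_C]
    ring
  rw [aroots, hq, roots_C_mul _ (by simp [ha0]), roots_multiset_prod_X_sub_C, aroots, ← hZ]

theorem iterate_graeffe_ne_zero {p : ℝ[X]} (hp : p ≠ 0) (h : ℕ) : graeffe^[h] p ≠ 0 := by
  induction h with
  | zero => exact hp
  | succ h ih => rw [Function.iterate_succ_apply']; exact graeffe_ne_zero ih

theorem natDegree_iterate_graeffe_le (p : ℝ[X]) (h : ℕ) :
    (graeffe^[h] p).natDegree ≤ p.natDegree := by
  induction h with
  | zero => rfl
  | succ h ih => rw [Function.iterate_succ_apply']; exact (natDegree_graeffe_le _).trans ih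

theorem aroots_iterate_graeffe {p : ℝ[X]} (hp : p ≠ 0) (h : ℕ) :
    (graeffe^[h] p).aroots ℂ = (p.aroots ℂ).map (· ^ 2 ^ h) := by
  induction h with
  | zero => simp
  | succ h ih =>
    rw [Function.iterate_succ_apply', aroots_graeffe (iterate_graeffe_ne_zero hp h), ih,
      Multiset.map_map]
    refine Multiset.map_congr rfl fun z _ => ?_
    simp only [Function.comp_apply]
    rw [← pow_mul, ← pow_succ]

/-- The coefficients of a polynomial that depends on the input. -/
def coeffSet {X : Type*} (p : X → ℝ[X]) : Set (X → ℝ) := {g | ∃ i, g = fun x => (p x).coeff i}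

theorem available_coeff {X : Type*} (p : X → ℝ[X]) (i : ℕ) :
    Available (coeffSet p) fun x => (p x).coeff i := .of_mem ⟨i, rfl⟩

/-- One root-squaring step by fast Fourier transforms. -/
theorem StraightLine.graeffe {X : Type*} (p : X → ℝ[X]) (k : ℕ)
    (hp : ∀ x, (p x).natDegree < 2 ^ k) :
    StraightLine (coeffSet p) (31 * (k + 1) * 2 ^ k) (coeffSet fun x => _root_.graeffe (p x)) := by
  have hpow : 2 ^ (k + 1) = 2 * 2 ^ k := pow_succ' 2 k
  have hpos : 0 < 2 ^ k := by positivity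
  obtain ⟨w, hw⟩ : ∃ w : ℂ, IsPrimitiveRoot w (2 ^ (k + 1)) :=
    ⟨_, Complex.isPrimitiveRoot_exp (2 ^ (k + 1)) (pow_pos two_pos _).ne'⟩
  have hw2 : IsPrimitiveRoot (w ^ 2) (2 ^ k) := hw.pow (pow_pos two_pos _) hpow
  -- Hence `-w ^ j = w ^ (j + 2 ^ k)`, and one transform of length `2 ^ (k + 1)` yields both factors
  -- of `p (w ^ j) * p (-w ^ j)`. These products are the values of the new polynomial at the powers
  -- of `w ^ 2`; its degree is below `2 ^ k`, so an inverse transform of length `2 ^ k` recovers it.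
  have hwneg : w ^ 2 ^ k = -1 := by
    have h1 : (w ^ 2 ^ k) ^ 2 = 1 := by rw [← pow_mul, ← pow_succ, hw.pow_eq_one]
    exact (mul_self_eq_one_iff.mp ((sq _).symm.trans h1)).resolve_left
      (hw.pow_ne_one_of_pos_of_lt hpos.ne' (by omega))
  set P := fourierSum (2 ^ (k + 1)) w fun i x => (((p x).coeff i : ℝ) : ℂ) with hP
  have hPx : ∀ j x, P j x = aeval (w ^ j) (p x) := by
    intro j x
    rw [aeval_eq_sum_range' ((hp x).trans (by omega : 2 ^ k < 2 ^ (k + 1)))]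
    refine Finset.sum_congr rfl fun i _ => ?_
    rw [Complex.real_smul, ← pow_mul, mul_comm i j]
  set G : ℕ → X → ℂ := fun j x => P j x * P (j + 2 ^ k) x with hG
  have hGx : ∀ j x, G j x = aeval ((w ^ 2) ^ j) (_root_.graeffe (p x)) := by
    intro j x
    rw [← pow_mul, mul_comm 2 j, pow_mul, aeval_graeffe]
    simp only [hG, hPx, pow_add, hwneg, mul_neg_one]
  set I := fourierSum (2 ^ k) (w ^ 2)⁻¹ G with hI
  have hIx : ∀ m < 2 ^ k, ∀ x, (I m x).re * ((2 ^ k : ℝ)⁻¹) = (_root_.graeffe (p x)).coeff m := by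
    intro m hm x
    have h := hw2.sum_aeval_mul_inv_pow (_root_.graeffe (p x))
      ((natDegree_graeffe_le _).trans_lt (hp x)) hm
    simp only [← hGx] at h
    rw [hI, fourierSum, h, Complex.ofReal_re]
    push_cast
    field_simp
  have h₁ : StraightLine (coeffSet p) (8 * (k + 1) * 2 ^ (k + 1))
      (complexParts P (2 ^ (k + 1))) := by
    refine StraightLine.fft (k + 1) w hw.pow_eq_one _ (fun i _ => ?_) fun i _ => ?_
    · simpa using available_coeff p i
    · simpa using Available.const _ 0
  have h₂ : StraightLine (coeffSet p ∪ complexParts P (2 ^ (k + 1))) (2 ^ k * 6)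
      (complexParts G (2 ^ k)) := by
    refine StraightLine.iUnion _ fun j hj => ?_
    have hj1 : j < 2 ^ (k + 1) := by omega
    have hj2 : j + 2 ^ k < 2 ^ (k + 1) := by omega
    have av : ∀ g ∈ complexParts P (2 ^ (k + 1)),
        StraightLine (coeffSet p ∪ complexParts P (2 ^ (k + 1))) 0 {g} :=
      fun g hg => .of_available (.of_mem (Or.inr hg))
    have a1 := av _ (re_mem_complexParts P hj1)
    have a2 := av _ (im_mem_complexParts P hj1)
    have b1 := av _ (re_mem_complexParts P hj2)
    have b2 := av _ (im_mem_complexParts P hj2)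
    simp only [hG, Complex.mul_re, Complex.mul_im]
    exact ((a1.mul b1).sub (a2.mul b2)).union ((a1.mul b2).add (a2.mul b1))
  have h₃ : StraightLine (complexParts G (2 ^ k)) (8 * k * 2 ^ k) (complexParts I (2 ^ k)) :=
    StraightLine.fft k _ (by rw [inv_pow, hw2.pow_eq_one, inv_one]) _
      (fun i hi => .of_mem (re_mem_complexParts G hi))
      fun i hi => .of_mem (im_mem_complexParts G hi)
  have h₄ : StraightLine (complexParts I (2 ^ k)) (2 ^ k * 1)
      {g | ∃ m < 2 ^ k, g ∈ ({fun x => (I m x).re * ((2 ^ k : ℝ)⁻¹)} : Set (X → ℝ))} :=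
    StraightLine.iUnion _ fun m hm =>
      (StraightLine.of_available (.of_mem (re_mem_complexParts I hm))).mul (.const _ _)
  have h := (h₁.trans h₂).trans
    ((h₃.trans (h₄.mono_left Set.subset_union_right)).mono_left Set.subset_union_right)
  refine (h.mono_cost ?_).of_available_right ?_
  · rw [hpow]
    nlinarith [Nat.zero_le (k * 2 ^ k)]
  · rintro g ⟨m, rfl⟩
    by_cases hm : m < 2 ^ k
    · exact .of_mem ⟨m, hm, by simp [hIx m hm]⟩
    · refine Or.inr ⟨0, funext fun x => coeff_eq_zero_of_natDegree_lt ?_⟩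
      exact (natDegree_graeffe_le _).trans_lt ((hp x).trans_le (not_lt.mp hm))

theorem StraightLine.iterate_graeffe {X : Type*} (p : X → ℝ[X]) (k h : ℕ)
    (hp : ∀ x, (p x).natDegree < 2 ^ k) :
    StraightLine (coeffSet p) (h * (31 * (k + 1) * 2 ^ k))
      (coeffSet fun x => _root_.graeffe^[h] (p x)) := by
  induction h with
  | zero => exact .nil _ fun f hf => .of_mem hf
  | succ h ih =>
    rw [Nat.succ_mul]
    simp only [Function.iterate_succ_apply']
    exact ih.trans ((StraightLine.graeffe _ k fun x =>
      (natDegree_iterate_graeffe_le _ h).trans_lt (hp x)).mono_left Set.subset_union_right)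

/-! ### Counting roots by sampling the logarithmic derivative -/

/-- The sum of `Re (u * q' u / q u)` over the points `u = 3 * v ^ j`, `j < N`. -/
noncomputable def logDerivSum (N : ℕ) (v : ℂ) (q : ℝ[X]) : ℝ :=
  ∑ j ∈ Finset.range N, (aeval (3 * v ^ j) (X * derivative q) / aeval (3 * v ^ j) q).re

/-- The weights `w` cover both `q` (weights 1) and `X * derivative q` (weights `i`). As `u` is
fixed, the numbers `w i * u ^ i` are constants of the program and cost nothing. -/
theorem StraightLine.aeval_parts {X : Type*} {K : Set (X → ℝ)} (q : X → ℝ[X]) (u : ℂ) (m : ℕ)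
    (w : ℕ → ℝ) (r : X → ℝ[X])
    (hr : ∀ x, (r x).natDegree < m) (hrq : ∀ x i, (r x).coeff i = (q x).coeff i * w i)
    (hK : ∀ i, Available K fun x => (q x).coeff i) :
    StraightLine K (2 * m) {fun x => (aeval u (r x)).re} ∧
      StraightLine K (2 * m) {fun x => (aeval u (r x)).im} := by
  have h : ∀ x, aeval u (r x) =
      ∑ i ∈ Finset.range m, (((q x).coeff i : ℝ) : ℂ) * ((w i : ℂ) * u ^ i) := by
    intro x
    rw [aeval_eq_sum_range' (hr x)]
    refine Finset.sum_congr rfl fun i _ => ?_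
    rw [Complex.real_smul, hrq]
    push_cast
    ring
  simp only [h, Complex.re_sum, Complex.im_sum, Complex.re_ofReal_mul (_ : ℝ),
    Complex.im_ofReal_mul (_ : ℝ)]
  exact ⟨.linearCombination (fun i => w i * (u ^ i).re) m fun i _ => hK i,
    .linearCombination (fun i => w i * (u ^ i).im) m fun i _ => hK i⟩

theorem coeff_X_mul_derivative (q : ℝ[X]) (i : ℕ) :
    (X * derivative q).coeff i = q.coeff i * i := by
  cases i with
  | zero => simp
  | succ i => rw [coeff_X_mul, coeff_derivative]; push_cast; ring

theorem natDegree_X_mul_derivative_le (q : ℝ[X]) :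
    (X * derivative q).natDegree ≤ q.natDegree := by
  rw [natDegree_le_iff_coeff_eq_zero]
  intro i hi
  rw [coeff_X_mul_derivative, coeff_eq_zero_of_natDegree_lt hi, zero_mul]

theorem StraightLine.logDerivSum {Y : Type*} (q : Y → ℝ[X]) (N n : ℕ) (v : ℂ)
    (hq : ∀ x, (q x).natDegree ≤ n) (h0 : ∀ x, ∀ j < N, aeval (3 * v ^ j) (q x) ≠ 0) :
    StraightLine (coeffSet q) (N * (12 * n + 20)) {fun x => _root_.logDerivSum N v (q x)} := by
  refine (StraightLine.sum (a := 12 * (n + 1) + 7) N fun j hj => ?_).mono_cost (le_of_eq (by ring))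
  obtain ⟨a1, a2⟩ := StraightLine.aeval_parts (K := coeffSet q) q (3 * v ^ j) (n + 1)
    (fun i => i) (fun x => X * derivative (q x))
    (fun x => Nat.lt_succ_of_le ((natDegree_X_mul_derivative_le _).trans (hq x)))
    (fun x => coeff_X_mul_derivative (q x)) (available_coeff q)
  obtain ⟨b1, b2⟩ := StraightLine.aeval_parts (K := coeffSet q) q (3 * v ^ j) (n + 1)
    (fun _ => 1) q
    (fun x => Nat.lt_succ_of_le (hq x)) (by simp) (available_coeff q)
  have hd : ∀ z y : ℂ, (z / y).re = (z.re * y.re + z.im * y.im) / (y.re * y.re + y.im * y.im) := by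
    intro z y
    rw [Complex.div_re, Complex.normSq_apply, add_div]
  simp only [hd]
  set L : Set (Y → ℝ) := {fun x => (aeval (3 * v ^ j) (X * derivative (q x))).re} ∪
    {fun x => (aeval (3 * v ^ j) (X * derivative (q x))).im} ∪
    ({fun x => (aeval (3 * v ^ j) (q x)).re} ∪ {fun x => (aeval (3 * v ^ j) (q x)).im}) with hL
  have av : ∀ g ∈ L, StraightLine (coeffSet q ∪ L) 0 {g} :=
    fun g hg => .of_available (.of_mem (Or.inr hg))
  have c1 := av _ (Or.inl (Or.inl rfl))
  have c2 := av _ (Or.inl (Or.inr rfl))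
  have d1 := av _ (Or.inr (Or.inl rfl))
  have d2 := av _ (Or.inr (Or.inr rfl))
  refine (((a1.union a2).union (b1.union b2)).trans
    (((c1.mul d1).add (c2.mul d2)).div ((d1.mul d1).add (d2.mul d2)) fun x => ?_)).mono_cost
    (by omega)
  rw [← Complex.normSq_apply]
  exact fun h => h0 x j hj (Complex.normSq_eq_zero.mp h)

/-- Partial fractions of the logarithmic derivative, with `u / (u - z) = 1 / (1 - z / u)`. -/
theorem aeval_X_mul_derivative_div {q : ℝ[X]} {u : ℂ} (hu : u ≠ 0) (hq : aeval u q ≠ 0) :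
    aeval u (X * derivative q) / aeval u q =
      ((q.aroots ℂ).map fun z => (1 - z / u)⁻¹).sum := by
  have hs := IsAlgClosed.splits (q.map (algebraMap ℝ ℂ))
  have he : eval u (q.map (algebraMap ℝ ℂ)) = aeval u q := eval_map_algebraMap _ _
  have h := hs.eval_derivative_div_eval_of_ne_zero (x := u) (by rwa [he])
  rw [derivative_map, he, eval_map_algebraMap] at h
  rw [map_mul, aeval_X, mul_div_assoc, h, ← Multiset.sum_map_mul_left]
  refine congrArg Multiset.sum (Multiset.map_congr rfl fun z _ => ?_)
  rw [one_sub_div hu, inv_div, mul_one_div]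

theorem logDerivSum_eq {q : ℝ[X]} {N : ℕ} (hN : 0 < N) {v : ℂ} (hv : IsPrimitiveRoot v N)
    (h0 : ∀ j < N, aeval (3 * v ^ j) q ≠ 0) (hz : ∀ z ∈ q.aroots ℂ, (z / 3) ^ N ≠ 1) :
    logDerivSum N v q = N * ((q.aroots ℂ).map fun z => (1 - (z / 3) ^ N)⁻¹).sum.re := by
  have hv0 : v ≠ 0 := hv.ne_zero hN.ne'
  have h : ∑ j ∈ Finset.range N, aeval (3 * v ^ j) (X * derivative q) / aeval (3 * v ^ j) q =
      N * ((q.aroots ℂ).map fun z => (1 - (z / 3) ^ N)⁻¹).sum := by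
    rw [← Multiset.sum_map_mul_left, Finset.sum_congr rfl fun j hj =>
      aeval_X_mul_derivative_div (by simp [hv0]) (h0 j (Finset.mem_range.mp hj)),
      ← Multiset.sum_map_sum]
    refine congrArg Multiset.sum (Multiset.map_congr rfl fun z hzq => ?_)
    -- The sample point stands in the denominator of `z / u`, so the average runs over the powers of
    -- `v⁻¹`.
    rw [← hv.inv.sum_inv_one_sub_mul_pow hN (hz z hzq)]
    refine Finset.sum_congr rfl fun j _ => ?_
    rw [inv_pow, ← div_eq_mul_inv, div_div]
  rw [logDerivSum, ← Complex.re_sum, h, ← Complex.ofReal_natCast, Complex.re_ofReal_mul]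

open Classical in
-- Inside `S` the error of a term is `|f / (1 - f)| ≤ R⁻¹ / (1 - R⁻¹)`, outside it is `|1 / (1 - f)|
-- ≤ 1 / (R - 1)`; the two bounds coincide.
theorem norm_sum_inv_sub_countP_le (Z : Multiset ℂ) {R : ℝ} (hR : 1 < R) (f : ℂ → ℂ) (S : Set ℂ)
    (hin : ∀ z ∈ Z, z ∈ S → ‖f z‖ ≤ R⁻¹) (hout : ∀ z ∈ Z, z ∉ S → R ≤ ‖f z‖) :
    ‖(Z.map fun z => (1 - f z)⁻¹).sum - (Z.countP (· ∈ S) : ℂ)‖ ≤ Z.card * (R - 1)⁻¹ := by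
  induction Z using Multiset.induction_on with
  | empty => simp
  | cons a Z ih =>
    have ih := ih (fun z hz => hin z (Multiset.mem_cons_of_mem hz))
      fun z hz => hout z (Multiset.mem_cons_of_mem hz)
    have ha : ‖(1 - f a)⁻¹ - if a ∈ S then 1 else 0‖ ≤ (R - 1)⁻¹ := by
      have hR1 : 0 < R - 1 := by linarith
      split_ifs with h
      · have h1 := hin a (Multiset.mem_cons_self a Z) h
        have hRi : R⁻¹ < 1 := inv_lt_one_of_one_lt₀ hR
        have h2 : 1 - R⁻¹ ≤ ‖1 - f a‖ := by
          have := norm_sub_norm_le (1 : ℂ) (f a)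
          rw [norm_one] at this
          linarith
        have h3 : 1 - f a ≠ 0 := norm_pos_iff.mp (by linarith)
        have h4 : (1 - f a)⁻¹ - 1 = f a / (1 - f a) := by field_simp; ring
        rw [h4, norm_div, div_le_iff₀ (norm_pos_iff.mpr h3)]
        calc ‖f a‖ ≤ R⁻¹ := h1
          _ = (R - 1)⁻¹ * (1 - R⁻¹) := by
            have : R ≠ 0 := by linarith
            field_simp
          _ ≤ _ := by gcongr
      · have h1 := hout a (Multiset.mem_cons_self a Z) h
        have h2 : R - 1 ≤ ‖1 - f a‖ := by
          have := norm_sub_norm_le (f a) 1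
          rw [norm_one, norm_sub_rev] at this
          linarith
        rw [sub_zero, norm_inv]
        exact inv_anti₀ hR1 h2
    have he : ((a ::ₘ Z).map fun z => (1 - f z)⁻¹).sum - ((a ::ₘ Z).countP (· ∈ S) : ℂ) =
        ((Z.map fun z => (1 - f z)⁻¹).sum - (Z.countP (· ∈ S) : ℂ)) +
          ((1 - f a)⁻¹ - if a ∈ S then 1 else 0) := by
      rw [Multiset.map_cons, Multiset.sum_cons, Multiset.countP_cons]
      split_ifs <;> push_cast <;> ring
    rw [he, Multiset.card_cons]
    push_cast
    rw [add_mul, one_mul]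
    exact (norm_add_le _ _).trans (add_le_add ih ha)

/-! ### Isolation of the unit disc after root squaring -/

theorem norm_le_one_or_lt_of_isIsolatedDisc {p : ℝ[X]} {h : ℕ}
    (hp : IsIsolatedDisc p ((9 : ℝ) ^ ((1 : ℝ) / 2 ^ h)) 0 1) {z : ℂ} (hz : aeval z p = 0) :
    ‖z‖ ≤ 1 ∨ 9 < ‖z ^ 2 ^ h‖ := by
  by_cases hle : ‖z‖ ≤ (9 : ℝ) ^ ((1 : ℝ) / 2 ^ h)
  · left
    simpa using hp z hz (by simpa using hle)
  · right
    have h9 : ((9 : ℝ) ^ ((1 : ℝ) / 2 ^ h)) ^ 2 ^ h = 9 := by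
      rw [← Real.rpow_natCast, ← Real.rpow_mul (by norm_num)]
      push_cast
      rw [one_div, inv_mul_cancel₀ (by positivity), Real.rpow_one]
    rw [norm_pow, ← h9]
    exact pow_lt_pow_left₀ (not_le.mp hle) (by positivity) (by positivity)

theorem norm_of_mem_aroots_iterate_graeffe {p : ℝ[X]} (hp0 : p ≠ 0) {h : ℕ}
    (hp : IsIsolatedDisc p ((9 : ℝ) ^ ((1 : ℝ) / 2 ^ h)) 0 1) {z : ℂ}
    (hz : z ∈ (graeffe^[h] p).aroots ℂ) : ‖z‖ ≤ 1 ∨ 9 < ‖z‖ := by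
  rw [aroots_iterate_graeffe hp0, Multiset.mem_map] at hz
  obtain ⟨y, hy, rfl⟩ := hz
  refine (norm_le_one_or_lt_of_isIsolatedDisc hp (mem_aroots.mp hy).2).imp_left fun h1 => ?_
  rw [norm_pow]
  exact pow_le_one₀ (norm_nonneg _) h1

open Classical in
theorem rootCount_eq_countP_iterate_graeffe {p : ℝ[X]} (hp0 : p ≠ 0) (h : ℕ) :
    rootCount p 0 1 =
      ((graeffe^[h] p).aroots ℂ).countP (· ∈ Metric.closedBall (0 : ℂ) 1) := by
  rw [aroots_iterate_graeffe hp0, Multiset.countP_map, rootCount, Multiset.countP_eq_card_filter]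
  refine congrArg Multiset.card (Multiset.filter_congr fun z _ => ?_)
  simp only [mem_closedBall_zero_iff, norm_pow]
  exact (pow_le_one_iff_of_nonneg (norm_nonneg _) (by positivity)).symm

theorem rootCount_le_natDegree (p : ℝ[X]) (c : ℂ) (r : ℝ) : rootCount p c r ≤ p.natDegree := by
  classical
  refine (Multiset.countP_le_card _ _).trans ((card_roots' _).trans ?_)
  exact natDegree_map_le

/-- Sampling the logarithmic derivative at `N` points determines the number of roots in
the unit disc if no root has absolute value in `(1, 9]` and `3 ^ N` is large. -/
theorem abs_logDerivSum_sub_lt {q : ℝ[X]} (hq0 : q ≠ 0)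
    (hq : ∀ z ∈ q.aroots ℂ, ‖z‖ ≤ 1 ∨ 9 < ‖z‖) {N : ℕ} (hN : 0 < N)
    (hdeg : 2 * q.natDegree + 1 < 3 ^ N) {v : ℂ} (hv : IsPrimitiveRoot v N) :
    (∀ j < N, aeval (3 * v ^ j) q ≠ 0) ∧
      |logDerivSum N v q - N * rootCount q 0 1| < N / 2 := by
  classical
  -- The radius 3 is the geometric mean of 1 and 9, so the sampling circle lies in the root-free
  -- annulus.
  have h0 : ∀ j < N, aeval (3 * v ^ j) q ≠ 0 := by
    intro j _ h
    have hn : ‖3 * v ^ j‖ = 3 := by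
      rw [norm_mul, norm_pow, hv.norm'_eq_one hN.ne']
      norm_num
    rcases hq _ (mem_aroots.mpr ⟨hq0, h⟩) with h1 | h1 <;> rw [hn] at h1 <;> norm_num at h1
  have hR : (1 : ℝ) < 3 ^ N := one_lt_pow₀ (by norm_num) hN.ne'
  have hin : ∀ z ∈ q.aroots ℂ, z ∈ Metric.closedBall (0 : ℂ) 1 →
      ‖(z / 3) ^ N‖ ≤ ((3 : ℝ) ^ N)⁻¹ := by
    intro z _ hz1
    rw [mem_closedBall_zero_iff] at hz1
    rw [norm_pow, ← inv_pow, norm_div, Complex.norm_ofNat]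
    exact pow_le_pow_left₀ (by positivity) (by linarith) N
  have hout : ∀ z ∈ q.aroots ℂ, z ∉ Metric.closedBall (0 : ℂ) 1 →
      (3 : ℝ) ^ N ≤ ‖(z / 3) ^ N‖ := by
    intro z hz hz1
    rw [mem_closedBall_zero_iff] at hz1
    have h9 := (hq z hz).resolve_left hz1
    rw [norm_pow, norm_div, Complex.norm_ofNat]
    exact pow_le_pow_left₀ (by norm_num) (by linarith) N
  have hne : ∀ z ∈ q.aroots ℂ, (z / 3) ^ N ≠ 1 := by
    intro z hz h1
    by_cases hz1 : z ∈ Metric.closedBall (0 : ℂ) 1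
    · have h2 := hin z hz hz1
      rw [h1, norm_one] at h2
      exact absurd (inv_lt_one_of_one_lt₀ hR) (not_lt.mpr h2)
    · have h2 := hout z hz hz1
      rw [h1, norm_one] at h2
      linarith
  refine ⟨h0, ?_⟩
  have hb := norm_sum_inv_sub_countP_le (q.aroots ℂ) hR (fun z => (z / 3) ^ N)
    (Metric.closedBall (0 : ℂ) 1) hin hout
  set S := ((q.aroots ℂ).map fun z => (1 - (z / 3) ^ N)⁻¹).sum with hS
  have hre : |S.re - rootCount q 0 1| ≤ (q.aroots ℂ).card * ((3 : ℝ) ^ N - 1)⁻¹ := by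
    refine le_trans (le_of_eq_of_le ?_ (Complex.abs_re_le_norm _)) hb
    simp [rootCount]
  have hlt : ((q.aroots ℂ).card : ℝ) * ((3 : ℝ) ^ N - 1)⁻¹ < 1 / 2 := by
    have hc : (q.aroots ℂ).card ≤ q.natDegree := (card_roots' _).trans natDegree_map_le
    have h2 : 2 * (q.aroots ℂ).card + 1 < 3 ^ N := by omega
    have h3 : 2 * ((q.aroots ℂ).card : ℝ) + 1 < 3 ^ N := by exact_mod_cast h2
    rw [← div_eq_mul_inv, div_lt_iff₀ (by linarith)]
    linarith
  have hN' : (0 : ℝ) < N := by exact_mod_cast hN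
  rw [logDerivSum_eq hN hv h0 hne, ← mul_sub, abs_mul, abs_of_pos hN']
  calc (N : ℝ) * |S.re - rootCount q 0 1| < N * (1 / 2) :=
        mul_lt_mul_of_pos_left (hre.trans_lt hlt) hN'
    _ = N / 2 := by ring

/-! ### Assembling the tree and bounding its cost -/

theorem natLog_two_add_two_le {n : ℕ} (hn : 1 ≤ n) :
    ((Nat.log 2 n + 2 : ℕ) : ℝ) ≤ 5 * Real.log (n + 1) := by
  have h2 := Real.log_two_gt_d9
  have hn' : (1 : ℝ) ≤ n := by exact_mod_cast hn
  have h1 : Real.log 2 ≤ Real.log (n + 1) := Real.log_le_log (by norm_num) (by linarith)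
  have h3 : (Nat.log 2 n : ℝ) * Real.log 2 ≤ Real.log (n + 1) := by
    rw [← Real.log_pow]
    refine Real.log_le_log (by positivity) ?_
    have : (2 : ℝ) ^ Nat.log 2 n ≤ n := by exact_mod_cast Nat.pow_log_le_self 2 (by omega)
    linarith
  have h4 : (0 : ℝ) ≤ Nat.log 2 n := by positivity
  push_cast
  nlinarith

/-- Input: register `i` initially holds the coefficient of `x ^ i` (and `0` for `i > n`). -/
theorem corollaryD1 :
    ∃ C : ℝ, ∀ n h : ℕ, 1 ≤ n → 1 ≤ h →
      ∃ T : CompTree,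
        (T.flops : ℝ) ≤ C * (h * n * Real.log (n + 1)) ∧
        (T.comparisons : ℝ) ≤ C * n ∧
        ∀ p : Polynomial ℝ, p.degree = n →
          IsIsolatedDisc p ((9 : ℝ) ^ ((1 : ℝ) / 2 ^ h)) 0 1 →
          T.run (fun i => p.coeff i) = some (rootCount p 0 1) := by
  refine ⟨500, fun n h hn hh => ?_⟩
  -- With this choice `n < 2 ^ k ≤ 2 * n`, so the transforms have length `O(n)`. The number of
  -- sample points is `k + 1`, and `3 ^ (k + 1) ≥ 3 * 2 ^ k > 2 * n + 1` makes it sufficient.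
  set k := Nat.log 2 n + 1 with hk
  have hnk : n < 2 ^ k := Nat.lt_pow_succ_log_self one_lt_two n
  have hkn : 2 ^ k ≤ 2 * n := by
    rw [hk, pow_succ']
    exact Nat.mul_le_mul_left 2 (Nat.pow_log_le_self 2 (by omega))
  obtain ⟨v, hv⟩ : ∃ v : ℂ, IsPrimitiveRoot v (k + 1) :=
    ⟨_, Complex.isPrimitiveRoot_exp _ (by omega)⟩
  have h3k : 2 * n + 1 < 3 ^ (k + 1) := by
    have : 2 ^ k ≤ 3 ^ k := Nat.pow_le_pow_left (by norm_num) k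
    rw [pow_succ]
    omega
  -- Straight-line programs must never divide by zero, so the input type contains only the
  -- admissible polynomials.
  let Input := {p : ℝ[X] // p.degree = n ∧ IsIsolatedDisc p ((9 : ℝ) ^ ((1 : ℝ) / 2 ^ h)) 0 1}
  have hdeg : ∀ p : Input, p.1.natDegree = n := fun p => natDegree_eq_of_degree_eq_some p.2.1
  have hne : ∀ p : Input, p.1 ≠ 0 := fun p h0 => by
    have := p.2.1
    rw [h0, degree_zero] at this
    exact absurd this (by simp)
  let q : Input → ℝ[X] := fun p => graeffe^[h] p.1
  have hqdeg : ∀ p, (q p).natDegree ≤ n := fun p =>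
    (natDegree_iterate_graeffe_le p.1 h).trans (hdeg p).le
  have hcount : ∀ p : Input, rootCount (q p) 0 1 = rootCount p.1 0 1 := fun p =>
    (rootCount_eq_countP_iterate_graeffe (hne p) h).symm
  have happrox := fun p : Input => abs_logDerivSum_sub_lt (iterate_graeffe_ne_zero (hne p) h)
    (fun z hz => norm_of_mem_aroots_iterate_graeffe (hne p) p.2.2 hz) k.succ_pos
    (by have := hqdeg p; simp only [q] at this; omega) hv
  have hprog : StraightLine (coeffSet fun p : Input => p.1)
      (h * (31 * (k + 1) * 2 ^ k) + (k + 1) * (12 * n + 20))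
      {fun p => logDerivSum (k + 1) v (q p)} :=
    (StraightLine.iterate_graeffe _ k h fun p => (hdeg p).trans_lt hnk).trans
      ((StraightLine.logDerivSum q (k + 1) n v hqdeg fun p => (happrox p).1).mono_left
        Set.subset_union_right)
  have hprog' : StraightLine {g | ∃ i < n + 1, g = fun p : Input => p.1.coeff i}
      (h * (31 * (k + 1) * 2 ^ k) + (k + 1) * (12 * n + 20))
      {fun p => logDerivSum (k + 1) v (q p)} := by
    -- Coefficients beyond index `n` are the constant 0, so only the registers up to `n` are read
    -- and register `n + 1` onwards is free for work.
    refine hprog.of_available_left ?_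
    rintro g ⟨i, rfl⟩
    by_cases hi : i < n + 1
    · exact .of_mem ⟨i, hi, rfl⟩
    · refine Or.inr ⟨0, funext fun p => coeff_eq_zero_of_natDegree_lt ?_⟩
      rw [hdeg p]
      omega
  obtain ⟨T, hT1, hT2, hT3⟩ := hprog'.exists_tree_of_approx (n := n) (R := n + 1)
    (fun p i => p.1.coeff i) (by rintro g ⟨i, hi, rfl⟩; exact ⟨i, hi, fun _ => rfl⟩)
    ((k + 1 : ℕ) : ℝ) (fun p => rootCount p.1 0 1)
    (fun p => (rootCount_le_natDegree _ _ _).trans (hdeg p).le)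
    (fun p => by rw [← hcount p]; exact (happrox p).2)
  refine ⟨T, ?_, ?_, fun p hp hiso => hT3 ⟨p, hp, hiso⟩⟩
  -- In units of `h * n * (k + 1)`, squaring costs at most 62, sampling 32 and the rounding
  -- thresholds 1. The factor 5 from the logarithm then gives 500.
  · have hflops : T.flops ≤ 100 * (h * n * (k + 1)) := by
      have e1 : h * (31 * (k + 1) * 2 ^ k) ≤ h * (31 * (k + 1) * (2 * n)) := by gcongr
      have e2 : (k + 1) * (12 * n + 20) ≤ h * ((k + 1) * (32 * n)) :=
        le_trans (Nat.mul_le_mul_left _ (by omega)) (Nat.le_mul_of_pos_left _ hh)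
      have e3 : n ≤ h * n * (k + 1) := by
        rw [mul_right_comm]
        exact Nat.le_mul_of_pos_left n (by positivity)
      nlinarith
    have hf : (T.flops : ℝ) ≤ 100 * (h * n * ((k + 1 : ℕ) : ℝ)) := by exact_mod_cast hflops
    have hlog := natLog_two_add_two_le hn
    calc (T.flops : ℝ) ≤ 100 * (h * n * ((k + 1 : ℕ) : ℝ)) := hf
      _ ≤ 100 * (h * n * (5 * Real.log (n + 1))) := by gcongr
      _ = 500 * (h * n * Real.log (n + 1)) := by ring
  · rw [hT2]
    have : (0 : ℝ) ≤ n := by positivity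
    linarith
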